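/- A \emph{dcpo} is a poset (possibly empty, not necessarily with a least element) in which every nonempty directed subset has a supremum; $\mathbf{Dcpo}$ is the category of dcpos and Scott-continuous maps (maps preserving all suprema of nonempty directed subsets), with its finite products (cartesian product with the componentwise order). For a dcpo $X$, let $\mathcal{O}X$ be the lattice of Scott-open subsets of $X$. A \emph{continuous valuation} on $X$ is a Scott-continuous map $\nu\colon\mathcal{O}X\to[0,\infty]$ with $\nu(\emptyset)=0$ and $\nu(U\cup V)+\nu(U\cap V)=\nu(U)+\nu(V)$ for all $U,V\in\mathcal{O}X$. These form a dcpo $\mathbf{V}X$ under the order $\mu\le\nu\iff\forall U,\ \mu(U)\le\nu(U)$. For $x\in X$, $\delta_x(U)=1$ if $x\in U$ and $0$ otherwise. For a Scott-continuous map $h\colon X\to[0,\infty]$, put $\int h\,d\nu=\int_0^{\infty}\nu(h^{-1}(]t,\infty]))\,dt$. A \emph{simple} valuation is a finite sum $\sum_{i=1}^n r_i\delta_{x_i}$ with $r_i\in[0,\infty)$, and the dcpo $\mathbf{V}_mX$ of \emph{minimal valuations} is the smallest subset of $\mathbf{V}X$ that contains the simple valuations and is closed under suprema of nonempty directed subsets,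 with the induced order. A \emph{monad} $(T,\eta,{}^\dagger)$ on a category consists of an assignment $X\mapsto TX$ on objects, morphisms $\eta_X\colon X\to TX$, and for each $f\colon X\to TY$ a morphism $f^\dagger\colon TX\to TY$, such that $f^\dagger\circ\eta_X=f$, $\eta_X^\dagger=\mathrm{id}_{TX}$ and $(g^\dagger\circ f)^\dagger=g^\dagger\circ f^\dagger$; put $Tf=(\eta_Y\circ f)^\dagger$ for $f\colon X\to Y$. On a category with finite products it is \emph{strong}, with tensorial strength $t$, if $t_{X,Y}\colon X\times TY\to T(X\times Y)$ are morphisms natural in $X$ and $Y$ satisfying the usual coherence conditions with the left unitor, the associator, the unit $\eta$ and the multiplication $\mathrm{id}_{TX}^\dagger$. The dual strength $t'_{X,Y}\colon TX\times Y\to T(X\times Y)$ is obtained from $t_{Y,X}$ by swapping arguments and swapping back. The strong monad is \emph{commutative} if $t_{X,Y}^\dagger\circ t'_{X,TY}=t'^{\,\dagger}_{X,Y}\circ t_{TX,Y}\colon TX\times TY\to T(X\times Y)$ for all $X,Y$. \textbf{Statement.} The following formulas define morphisms of $\mathbf{Dcpo}$ that make $(\mathbf{V}_m,\eta,{}^\dagger,t)$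 a commutative strong monad on $\mathbf{Dcpo}$: \begin{itemize} \item $\eta_X\colon X\to\mathbf{V}_mX$, $\eta_X(x)=\delta_x$; \item for $f\colon X\to\mathbf{V}_mY$ Scott-continuous, $f^\dagger\colon\mathbf{V}_mX\to\mathbf{V}_mY$, $f^\dagger(\mu)(V)=\int_{x\in X}f(x)(V)\,d\mu$ for $V\in\mathcal{O}Y$; \item $t_{X,Y}\colon X\times\mathbf{V}_mY\to\mathbf{V}_m(X\times Y)$, $t_{X,Y}(x,\nu)(W)=\nu(\{y\in Y\mid (x,y)\in W\})$ for $W\in\mathcal{O}(X\times Y)$. \end{itemize} -/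

import Mathlib

open CategoryTheory MonoidalCategory CartesianMonoidalCategory Limits
open scoped ENNReal NNReal

/-! ### Monads in extension form, tensorial strengths, commutative monads -/

section Monads

universe v w

/-- A monad `(T, η, _†)` on `C` in extension form (Manes), with given action `T` on objects. -/
structure ManesMonad {C : Type w} [Category.{v} C] (T : C → C) where
  unit : ∀ X : C, X ⟶ T X
  ext : ∀ {X Y : C}, (X ⟶ T Y) → (T X ⟶ T Y)
  unit_ext : ∀ {X Y : C} (f : X ⟶ T Y), unit X ≫ ext f = f
  ext_unit : ∀ X : C, ext (unit X) = 𝟙 (T X)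
  ext_comp_ext : ∀ {X Y Z : C} (f : X ⟶ T Y) (g : Y ⟶ T Z), ext (f ≫ ext g) = ext f ≫ ext g

/-- The action of `T` on morphisms, `T f = (η ∘ f)†`. -/
def ManesMonad.map {C : Type w} [Category.{v} C] {T : C → C} (M : ManesMonad T) {X Y : C}
    (f : X ⟶ Y) : T X ⟶ T Y :=
  M.ext (f ≫ M.unit Y)

/-- The multiplication `id† : T (T X) ⟶ T X`. -/
def ManesMonad.mult {C : Type w} [Category.{v} C] {T : C → C} (M : ManesMonad T) (X : C) :
    T (T X) ⟶ T X :=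
  M.ext (𝟙 (T X))

/-- A strong monad `(T, η, _†, t)` on a category with chosen finite products: the tensorial
strength `t` is natural in both arguments and satisfies the four coherence conditions relating it
to the left unitor, the associator, the unit and the multiplication. -/
structure StrongMonad {C : Type w} [Category.{v} C] [CartesianMonoidalCategory C] (T : C → C)
    extends ManesMonad T where
  strength : ∀ X Y : C, X ⊗ T Y ⟶ T (X ⊗ Y)
  strength_natural : ∀ {X X' Y Y' : C} (f : X ⟶ X') (g : Y ⟶ Y'),
    (f ⊗ₘ toManesMonad.map g) ≫ strength X' Y' = strength X Y ≫ toManesMonad.map (f ⊗ₘ g)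
  strength_leftUnitor : ∀ X : C,
    strength (𝟙_ C) X ≫ toManesMonad.map (λ_ X).hom = (λ_ (T X)).hom
  strength_associator : ∀ X Y Z : C,
    strength (X ⊗ Y) Z ≫ toManesMonad.map (α_ X Y Z).hom =
      (α_ X Y (T Z)).hom ≫ (X ◁ strength Y Z) ≫ strength X (Y ⊗ Z)
  strength_unit : ∀ X Y : C, (X ◁ unit Y) ≫ strength X Y = unit (X ⊗ Y)
  strength_mult : ∀ X Y : C,
    (X ◁ toManesMonad.mult Y) ≫ strength X Y =
      strength X (T Y) ≫ toManesMonad.map (strength X Y) ≫ toManesMonad.mult (X ⊗ Y)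

/-- The swap `X ⊗ Y ⟶ Y ⊗ X`. -/
def prodSwap {C : Type w} [Category.{v} C] [CartesianMonoidalCategory C] (X Y : C) :
    X ⊗ Y ⟶ Y ⊗ X :=
  lift (snd X Y) (fst X Y)

/-- The dual tensorial strength `t' : T X ⊗ Y ⟶ T (X ⊗ Y)`: swap, apply `t`, swap back. -/
def StrongMonad.dualStrength {C : Type w} [Category.{v} C] [CartesianMonoidalCategory C]
    {T : C → C} (M : StrongMonad T) (X Y : C) : T X ⊗ Y ⟶ T (X ⊗ Y) :=
  prodSwap (T X) Y ≫ M.strength Y X ≫ M.map (prodSwap Y X)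

/-- A strong monad is commutative when `t† ∘ t' = t'† ∘ t` as morphisms
`T X ⊗ T Y ⟶ T (X ⊗ Y)`. -/
def StrongMonad.IsCommutative {C : Type w} [Category.{v} C] [CartesianMonoidalCategory C]
    {T : C → C} (M : StrongMonad T) : Prop :=
  ∀ X Y : C,
    M.dualStrength X (T Y) ≫ M.ext (M.strength X Y) =
      M.strength (T X) Y ≫ M.ext (M.dualStrength X Y)

end Monads

/-! ### The category of dcpos and Scott-continuous maps -/

universe u

/-- A dcpo: a poset (possibly empty, possibly without a least element) in which every (nonempty)
directed subset has a supremum. -/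
structure Dcpo where
  carrier : Type u
  [order : PartialOrder carrier]
  exists_isLUB : ∀ d : Set carrier, d.Nonempty → DirectedOn (· ≤ ·) d → ∃ a, IsLUB d a

namespace Dcpo

instance : CoeSort Dcpo.{u} (Type u) := ⟨Dcpo.carrier⟩

attribute [instance] Dcpo.order

/-- Scott-continuous maps: those preserving all (nonempty) directed suprema. -/
structure Hom (X Y : Dcpo.{u}) where
  toFun : X → Y
  scottContinuous' : ScottContinuous toFun

instance (X Y : Dcpo.{u}) : FunLike (Hom X Y) X Y where
  coe := Hom.toFun
  coe_injective := fun f g h => by cases f; cases g; congr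

instance : Category Dcpo.{u} where
  Hom := Hom
  id X := ⟨fun x => x, ScottContinuous.id⟩
  comp f g := ⟨fun x => g.toFun (f.toFun x), f.scottContinuous'.comp g.scottContinuous'⟩

instance : ConcreteCategory Dcpo.{u} Hom where
  hom f := f
  ofHom f := f

theorem scottContinuous {X Y : Dcpo.{u}} (f : X ⟶ Y) : ScottContinuous (f : X → Y) :=
  Hom.scottContinuous' f

/-- The one-point dcpo. -/
def point : Dcpo.{u} where
  carrier := PUnit
  exists_isLUB := fun _ _ _ => ⟨PUnit.unit, fun _ _ => le_rfl, fun _ _ => le_rfl⟩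

/-- The product of two dcpos, with the componentwise order. -/
def prod (X Y : Dcpo.{u}) : Dcpo.{u} where
  carrier := X × Y
  exists_isLUB := fun d hne hd => by
    obtain ⟨a, ha⟩ := X.exists_isLUB (Prod.fst '' d) (hne.image _) hd.fst
    obtain ⟨b, hb⟩ := Y.exists_isLUB (Prod.snd '' d) (hne.image _) hd.snd
    exact ⟨(a, b), isLUB_prod.2 ⟨ha, hb⟩⟩

/-- The product cone. -/
def prodCone (X Y : Dcpo.{u}) : BinaryFan X Y :=
  BinaryFan.mk (P := prod X Y)
    (show prod X Y ⟶ X from Hom.mk Prod.fst ScottContinuous.fst)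
    (show prod X Y ⟶ Y from Hom.mk Prod.snd ScottContinuous.snd)

instance : CartesianMonoidalCategory Dcpo.{u} :=
  .ofChosenFiniteProducts
    ⟨asEmptyCone point, IsTerminal.ofUniqueHom
      (fun _ => Hom.mk (fun _ => PUnit.unit) (ScottContinuous.const PUnit.unit))
      (fun _ _ => rfl)⟩
    fun X Y =>
    { cone := prodCone X Y
      isLimit := BinaryFan.isLimitMk
        (fun s => Hom.mk (fun z => (Hom.toFun s.fst z, Hom.toFun s.snd z))
          ((Hom.scottContinuous' s.fst).prodMk (Hom.scottContinuous' s.snd)))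
        (fun _ => rfl) (fun _ => rfl)
        (fun s m h₁ h₂ => by
          rw [← h₁, ← h₂]; rfl) }

/-- The element `(x, y)` of the product dcpo. -/
def pair {X Y : Dcpo.{u}} (x : X) (y : Y) : ↥(X ⊗ Y) := (show X × Y from (x, y))

theorem scottContinuous_pair {X Y : Dcpo.{u}} (x : X) :
    ScottContinuous (fun y : Y => (pair x y : ↥(X ⊗ Y))) :=
  ScottContinuous.prodMk (ScottContinuous.const x) ScottContinuous.id

end Dcpo

/-! ### Scott-open subsets, lower semicontinuous maps -/

/-- The lattice of Scott-open subsets of `X`. -/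
abbrev ScottOpens (X : Type u) [Preorder X] : Type u :=
  @TopologicalSpace.Opens X (Topology.scott X Set.univ)

theorem isOpen_scott_iff {X : Type u} [Preorder X] {s : Set X} :
    @IsOpen X (Topology.scott X Set.univ) s ↔ IsUpperSet s ∧ DirSupInacc s := by
  let _ : TopologicalSpace X := Topology.scott X Set.univ
  have : Topology.IsScott X Set.univ := ⟨rfl⟩
  rw [Topology.IsScott.isOpen_iff_isUpperSet_and_dirSupInaccOn (D := Set.univ),
    dirSupInaccOn_univ]

/-- The inverse image of a Scott-open subset under a Scott-continuous map. -/
def ScottOpens.preimage {X Y : Type u} [Preorder X] [Preorder Y] (f : X → Y)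
    (hf : ScottContinuous f) (V : ScottOpens Y) : ScottOpens X :=
  @TopologicalSpace.Opens.mk X (Topology.scott X Set.univ) {x | f x ∈ V} <| by
    obtain ⟨h₁, h₂⟩ := isOpen_scott_iff.1 (@TopologicalSpace.Opens.is_open' Y (Topology.scott Y Set.univ) V)
    refine isOpen_scott_iff.2 ⟨fun a b hab ha => h₁ (hf.monotone hab) ha, ?_⟩
    intro d hne hd a hda ha
    obtain ⟨_, ⟨x, hx, rfl⟩, hxV⟩ :=
      h₂ (hne.image f) (directedOn_image.2 (hd.mono fun _ _ hab => hf.monotone hab)) (hf hne hd hda) ha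
    exact ⟨x, hx, hxV⟩

/-- The space of Scott-continuous (that is, lower semicontinuous) maps from `X` to `[0, ∞]`. -/
structure LscMap (X : Type u) [Preorder X] where
  toFun : X → ℝ≥0∞
  scottContinuous' : ScottContinuous toFun

/-- The Scott-open set `h⁻¹ (]t, ∞])`. -/
def LscMap.superlevel {X : Type u} [Preorder X] (h : LscMap X) (t : ℝ≥0∞) : ScottOpens X :=
  @TopologicalSpace.Opens.mk X (Topology.scott X Set.univ) {x | t < h.toFun x} <| by
    refine isOpen_scott_iff.2
      ⟨fun a b hab ha => lt_of_lt_of_le ha (h.scottContinuous'.monotone hab), ?_⟩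
    intro d hne hd a hda ha
    obtain ⟨_, ⟨x, hx, rfl⟩, hxt⟩ :=
      (lt_isLUB_iff (h.scottContinuous' hne hd hda)).1 ha
    exact ⟨x, hx, hxt⟩

/-! ### Continuous valuations -/

/-- Continuous valuations on a poset `X` with its Scott topology. -/
structure Val (X : Type u) [PartialOrder X] where
  toFun : ScottOpens X → ℝ≥0∞
  scottContinuous' : ScottContinuous toFun
  strict' : toFun ⊥ = 0
  modular' : ∀ U V : ScottOpens X, toFun (U ⊔ V) + toFun (U ⊓ V) = toFun U + toFun V

namespace Val

variable {X : Type u} [PartialOrder X]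

instance : CoeFun (Val X) (fun _ => ScottOpens X → ℝ≥0∞) := ⟨Val.toFun⟩

theorem toFun_injective : Function.Injective (Val.toFun : Val X → ScottOpens X → ℝ≥0∞) :=
  fun μ ν h => by cases μ; cases ν; congr

/-- The stochastic order: `μ ≤ ν` iff `μ U ≤ ν U` for every open `U`. -/
instance : PartialOrder (Val X) := PartialOrder.lift Val.toFun toFun_injective

theorem le_def {μ ν : Val X} : μ ≤ ν ↔ ∀ U, μ U ≤ ν U := Iff.rfl

open Classical in
/-- The Dirac valuation at `x`. -/
noncomputable def dirac (x : X) : Val X where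
  toFun U := if x ∈ U then 1 else 0
  scottContinuous' := by
    intro d hne hd U hU
    have hsup : U = sSup d := hU.unique (isLUB_sSup d)
    subst hsup
    constructor
    · rintro _ ⟨V, hV, rfl⟩
      by_cases hx : x ∈ V
      · have : x ∈ sSup d := (le_sSup hV) hx
        simp [hx, this]
      · simp [hx]
    · intro b hb
      by_cases hx : x ∈ sSup d
      · obtain ⟨V, hV, hxV⟩ := (@TopologicalSpace.Opens.mem_sSup X (Topology.scott X Set.univ) d x).1 hx
        have := hb ⟨V, hV, rfl⟩
        simpa [hx, hxV] using this
      · simp [hx]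
  strict' := by simp
  modular' U V := by
    by_cases h₁ : x ∈ U <;> by_cases h₂ : x ∈ V <;> simp [h₁, h₂]

/-- The integral `∫ h dν`, given by the Choquet formula `∫₀^∞ ν (h⁻¹ (]t, ∞])) dt`. -/
noncomputable def integral (ν : Val X) (h : LscMap X) : ℝ≥0∞ :=
  ∫⁻ t in Set.Ioi (0 : ℝ), ν (h.superlevel (ENNReal.ofReal t))

/-- The pointwise supremum of a directed set of continuous valuations. -/
noncomputable def dirSup (d : Set (Val X)) (hd : DirectedOn (· ≤ ·) d) : Val X where
  toFun U := ⨆ ν : d, ν.1 U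
  scottContinuous' := by
    intro e hne he U hU
    constructor
    · rintro _ ⟨V, hV, rfl⟩
      exact iSup_mono fun ν => ν.1.scottContinuous'.monotone (hU.1 hV)
    · intro b hb
      refine iSup_le fun ν => (ν.1.scottContinuous' hne he hU).2 ?_
      rintro _ ⟨V, hV, rfl⟩
      exact (le_iSup (fun ν : d => ν.1 V) ν).trans (hb ⟨V, hV, rfl⟩)
  strict' := by simp [Val.strict']
  modular' U V := by
    have key : ∀ A B : ScottOpens X,
        (⨆ ν : d, ν.1 A) + (⨆ ν : d, ν.1 B) = ⨆ ν : d, (ν.1 A + ν.1 B) := by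
      intro A B
      refine ENNReal.iSup_add_iSup fun μ ν => ?_
      obtain ⟨ξ, hξ, h₁, h₂⟩ := hd μ.1 μ.2 ν.1 ν.2
      exact ⟨⟨ξ, hξ⟩, add_le_add (h₁ A) (h₂ B)⟩
    rw [key, key]
    exact iSup_congr fun ν => ν.1.modular' U V

theorem isLUB_dirSup (d : Set (Val X)) (hd : DirectedOn (· ≤ ·) d) : IsLUB d (dirSup d hd) := by
  constructor
  · intro ν hν U
    exact le_iSup (fun ν : d => ν.1 U) ⟨ν, hν⟩
  · intro μ hμ U
    exact iSup_le fun ν => hμ ν.2 U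

/-- Simple valuations: finite linear combinations `∑ rᵢ δ_{xᵢ}` with `rᵢ` in `[0, ∞)`. -/
def IsSimple (ν : Val X) : Prop :=
  ∃ (n : ℕ) (r : Fin n → ℝ≥0) (x : Fin n → X),
    ∀ U : ScottOpens X, ν U = ∑ i, (r i : ℝ≥0∞) * dirac (x i) U

end Val

/-- The inductive closure of `A`: the smallest set that contains `A` and is closed under
(nonempty) directed suprema. -/
def inductiveClosure {Z : Type u} [PartialOrder Z] (A : Set Z) : Set Z :=
  ⋂₀ {C | A ⊆ C ∧ DirSupClosed C}

theorem dirSupClosed_inductiveClosure {Z : Type u} [PartialOrder Z] (A : Set Z) :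
    DirSupClosed (inductiveClosure A) :=
  DirSupClosed.sInter fun _ hC => hC.2

/-- Minimal valuations: the elements of the inductive closure, in the dcpo of all continuous
valuations, of the set of simple valuations. -/
def Val.IsMinimal {X : Type u} [PartialOrder X] (ν : Val X) : Prop :=
  ν ∈ inductiveClosure {μ : Val X | μ.IsSimple}

theorem MinVal.image_dirSup {X : Type u} [PartialOrder X] {d : Set {ν : Val X // ν.IsMinimal}}
    (hne : d.Nonempty) (hd : DirectedOn (· ≤ ·) d) :
    ∃ h : DirectedOn (· ≤ ·) (Subtype.val '' d),
      ∃ hm : (Val.dirSup (Subtype.val '' d) h).IsMinimal,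
        IsLUB d ⟨Val.dirSup (Subtype.val '' d) h, hm⟩ := by
  have h : DirectedOn (· ≤ ·) (Subtype.val '' d) := by
    rintro _ ⟨μ, hμ, rfl⟩ _ ⟨ν, hν, rfl⟩
    obtain ⟨ξ, hξ, h₁, h₂⟩ := hd μ hμ ν hν
    exact ⟨ξ, ⟨ξ, hξ, rfl⟩, h₁, h₂⟩
  have hl := Val.isLUB_dirSup _ h
  refine ⟨h, dirSupClosed_inductiveClosure _ ?_ (hne.image _) h hl, ?_, ?_⟩
  · rintro _ ⟨ν, _, rfl⟩
    exact ν.2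
  · intro ν hν
    exact hl.1 ⟨ν, hν, rfl⟩
  · intro μ hμ
    refine hl.2 ?_
    rintro _ ⟨ν, hν, rfl⟩
    exact hμ hν

/-- The dcpo of minimal valuations on a dcpo `X`, in the stochastic order. -/
def MinVal (X : Dcpo.{u}) : Dcpo.{u} where
  carrier := {ν : Val X // ν.IsMinimal}
  exists_isLUB := fun _ hne hd => by
    obtain ⟨_, _, hl⟩ := MinVal.image_dirSup hne hd
    exact ⟨_, hl⟩

/-- The continuous valuation underlying a minimal valuation. -/
def MinVal.val {X : Dcpo.{u}} (ν : MinVal X) : Val X := Subtype.val ν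

theorem MinVal.scottContinuous_eval {X : Dcpo.{u}} (U : ScottOpens X) :
    ScottContinuous (fun ν : MinVal X => MinVal.val ν U) := by
  intro d hne hd a ha
  obtain ⟨h, hm, hl⟩ := MinVal.image_dirSup hne hd
  obtain rfl := ha.unique hl
  constructor
  · rintro _ ⟨ν, hν, rfl⟩
    exact (Val.isLUB_dirSup _ h).1 ⟨ν, hν, rfl⟩ U
  · intro b hb
    refine iSup_le ?_
    rintro ⟨_, ν, hν, rfl⟩
    exact hb ⟨ν, hν, rfl⟩

/-- For `f : X ⟶ MinVal Y` and `V` open in `Y`, the lower semicontinuous map `x ↦ f x V`. -/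
def MinVal.evalMap {X Y : Dcpo.{u}} (f : X ⟶ MinVal Y) (V : ScottOpens Y) : LscMap X where
  toFun x := MinVal.val (f x) V
  scottContinuous' := (Dcpo.scottContinuous f).comp (MinVal.scottContinuous_eval V)

/-- For `x` in `X` and `W` open in `X ⊗ Y`, the open set `{y | (x, y) ∈ W}` of `Y`. -/
def Dcpo.slice {X Y : Dcpo.{u}} (x : X) (W : ScottOpens ↥(X ⊗ Y)) : ScottOpens Y :=
  ScottOpens.preimage (fun y => Dcpo.pair x y) (Dcpo.scottContinuous_pair x) W

/-! Minimal valuations are generated from Dirac valuations by linear combinations and directed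
suprema. Hence two Scott-continuous linear maps out of `MinVal X` that agree on Diracs are equal
(`IsScottLinear.eq_of_dirac`), and every law of the theorem reduces to a computation with points.

The analytic input is that `∫ h dν` is linear and Scott-continuous in `ν`, with value `h x` at
`δ_x`. Given this, the same generation argument shows that `V ↦ ∫ f x V dμ` is a minimal valuation
whenever `μ` is minimal (`MinVal.exists_ext`), and that the extension is Scott-continuous, linear
and restricts to `f` on Diracs. The strength is itself an extension, namely of `y ↦ δ_(x,y)`.

For commutativity, both composites are Scott-continuous and linear in each measure separately, and
both send `(δ_x, δ_y)` to `δ_(x,y)`. This is Fubini, checked only on Diracs. -/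

namespace LscMap

variable {X : Type u} [PartialOrder X]

theorem mem_superlevel {h : LscMap X} {t : ℝ≥0∞} {x : X} :
    x ∈ h.superlevel t ↔ t < h.toFun x := Iff.rfl

theorem superlevel_antitone (h : LscMap X) : Antitone h.superlevel :=
  fun _ _ hst _ hx => lt_of_le_of_lt hst hx

/-- The superlevel set at `t` is the directed union of those at rationals above `t`. -/
theorem isLUB_superlevel (h : LscMap X) {t : ℝ} (ht : 0 ≤ t) :
    IsLUB ((fun q : ℚ => h.superlevel (ENNReal.ofReal q)) '' {q : ℚ | t < q})
      (h.superlevel (ENNReal.ofReal t)) := by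
  constructor
  · rintro _ ⟨q, hq, rfl⟩
    exact h.superlevel_antitone (ENNReal.ofReal_le_ofReal (le_of_lt hq))
  · intro U hU x hx
    obtain ⟨q, hq0, hq1, hq2⟩ := ENNReal.lt_iff_exists_rat_btwn.1 (mem_superlevel.1 hx)
    have htq : t < q := by
      rw [Real.toNNReal] at *
      exact (ENNReal.ofReal_lt_ofReal_iff_of_nonneg ht).1 hq1
    exact hU ⟨q, htq, rfl⟩ (mem_superlevel.2 hq2)

end LscMap

/-! ### Integration against a continuous valuation -/

namespace Val

variable {X : Type u} [PartialOrder X]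

theorem mono (ν : Val X) {U V : ScottOpens X} (h : U ≤ V) : ν U ≤ ν V :=
  ν.scottContinuous'.monotone h

theorem antitone_superlevel (ν : Val X) (h : LscMap X) :
    Antitone fun t : ℝ => ν (h.superlevel (ENNReal.ofReal t)) :=
  fun _ _ hst => ν.mono (h.superlevel_antitone (ENNReal.ofReal_le_ofReal hst))

/-- Right-continuity of the Choquet integrand: `ν` preserves the directed union of superlevel sets
over rationals above `t`. -/
theorem superlevel_le_iSup_rat (ν : Val X) (h : LscMap X) {t : ℝ} (ht : 0 ≤ t) {b : ℝ≥0∞}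
    (hb : ∀ q : ℚ, t < q → ν (h.superlevel (ENNReal.ofReal q)) ≤ b) :
    ν (h.superlevel (ENNReal.ofReal t)) ≤ b := by
  obtain ⟨q, hq⟩ := exists_rat_gt t
  refine (ν.scottContinuous' (Set.Nonempty.image _ ⟨q, hq⟩) ?_ (h.isLUB_superlevel ht)).2 ?_
  · rintro _ ⟨p, hp, rfl⟩ _ ⟨q, hq, rfl⟩
    refine ⟨_, ⟨min p q, by simpa using ⟨hp, hq⟩, rfl⟩, ?_, ?_⟩ <;>
    · refine h.superlevel_antitone (ENNReal.ofReal_le_ofReal ?_)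
      simp
  · rintro _ ⟨_, ⟨q, hq, rfl⟩, rfl⟩
    exact hb q hq

theorem integral_mono {μ ν : Val X} (hμν : μ ≤ ν) (h : LscMap X) :
    μ.integral h ≤ ν.integral h :=
  MeasureTheory.lintegral_mono fun _ => hμν _

theorem isLUB_apply {d : Set (Val X)} (hd : DirectedOn (· ≤ ·) d) {a : Val X} (ha : IsLUB d a)
    (U : ScottOpens X) : a U = ⨆ ν : d, ν.1 U := by
  rw [ha.unique (isLUB_dirSup d hd)]; rfl

/-- The integral is Scott-continuous in the valuation: by right-continuity of the integrands, a
countable directed subfamily computes the supremum, and monotone convergence applies. -/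
theorem integral_scottContinuous (h : LscMap X) :
    ScottContinuous fun ν : Val X => ν.integral h := by
  intro d hne hd a ha
  refine ⟨?_, ?_⟩
  · rintro _ ⟨ν, hν, rfl⟩
    exact integral_mono (ha.1 hν) h
  intro b hb
  have : Nonempty d := hne.to_subtype
  -- Monotone convergence needs a sequence, while `d` may be uncountable. At each rational level,
  -- countably many members of `d` already attain the supremum.
  have hseq : ∀ q : ℚ, ∃ s : ℕ → d,
      ⨆ ν : d, ν.1 (h.superlevel (ENNReal.ofReal q)) =
        ⨆ n, (s n).1 (h.superlevel (ENNReal.ofReal q)) := fun q => by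
    obtain ⟨s, _, hs, hlim⟩ := exists_seq_tendsto_sSup
      (S := Set.range fun ν : d => ν.1 (h.superlevel (ENNReal.ofReal q)))
      (Set.range_nonempty _) (OrderTop.bddAbove _)
    choose s' hs' using hlim
    refine ⟨s', ?_⟩
    simp only [hs']
    exact (iSup_eq_of_tendsto ‹_› hs).symm
  choose s hs using hseq
  -- The upper set of each `s q n` is cofinal by directedness. A monotone sequence meeting all these
  -- countably many cofinal sets eventually dominates every `s q n`.
  let D : ℚ × ℕ → Order.Cofinal d := fun p =>
    ⟨{ν | s p.1 p.2 ≤ ν}, fun ν => by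
      obtain ⟨ξ, hξ, h₁, h₂⟩ := hd _ (s p.1 p.2).2 _ ν.2
      exact ⟨⟨ξ, hξ⟩, h₁, h₂⟩⟩
  let c : ℕ → d := Order.sequenceOfCofinals (Classical.arbitrary d) D
  have hc : Monotone c := Order.sequenceOfCofinals.monotone _ D
  have hsc : ∀ q n, ∃ k, s q n ≤ c k := fun q n =>
    ⟨_, Order.sequenceOfCofinals.encode_mem (Classical.arbitrary d) D (q, n)⟩
  have key : ∀ t : ℝ, 0 ≤ t → a (h.superlevel (ENNReal.ofReal t)) ≤
      ⨆ k, (c k).1 (h.superlevel (ENNReal.ofReal t)) := by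
    intro t ht
    refine a.superlevel_le_iSup_rat h ht fun q hq => ?_
    rw [isLUB_apply hd ha, hs]
    refine iSup_le fun n => ?_
    obtain ⟨k, hk⟩ := hsc q n
    exact (hk _).trans ((mono _ (h.superlevel_antitone (ENNReal.ofReal_le_ofReal hq.le))).trans
      (le_iSup (fun k => (c k).1 (h.superlevel (ENNReal.ofReal t))) k))
  calc a.integral h
      ≤ ∫⁻ t in Set.Ioi (0 : ℝ), ⨆ k, (c k).1 (h.superlevel (ENNReal.ofReal t)) :=
        MeasureTheory.setLIntegral_mono' measurableSet_Ioi fun t ht => key t (le_of_lt ht)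
    _ = ⨆ k, (c k).1.integral h :=
        MeasureTheory.lintegral_iSup (fun k => ((c k).1.antitone_superlevel h).measurable)
          fun i j hij t => hc hij _
    _ ≤ b := iSup_le fun k => hb ⟨_, (c k).2, rfl⟩

/-- On `t > 0` the integrand is the indicator of `t < h x`, so the integral is the length of an
interval from `0` to `h x`. -/
theorem integral_dirac (x : X) (h : LscMap X) : (dirac x).integral h = h.toFun x := by
  classical
  have h1 : ∀ t : ℝ, dirac x (h.superlevel (ENNReal.ofReal t)) =
      Set.indicator {t : ℝ | ENNReal.ofReal t < h.toFun x} 1 t := fun t => by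
    simp [dirac, Set.indicator, LscMap.mem_superlevel]
  have hm : MeasurableSet {t : ℝ | ENNReal.ofReal t < h.toFun x} :=
    measurableSet_lt ENNReal.measurable_ofReal measurable_const
  simp only [integral, h1]
  rw [MeasureTheory.lintegral_indicator_one hm, MeasureTheory.Measure.restrict_apply hm]
  rcases eq_or_ne (h.toFun x) ∞ with hx | hx
  · simp [hx]
  · have : {t : ℝ | ENNReal.ofReal t < h.toFun x} ∩ Set.Ioi 0 = Set.Ioo 0 (h.toFun x).toReal := by
      ext t
      simp only [Set.mem_inter_iff, Set.mem_ofPred_eq, Set.mem_Ioi, Set.mem_Ioo]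
      rw [and_comm]
      refine and_congr_right fun ht => ?_
      rw [← ENNReal.ofReal_lt_ofReal_iff_of_nonneg ht.le, ENNReal.ofReal_toReal hx]
    rw [this, Real.volume_Ioo, sub_zero, ENNReal.ofReal_toReal hx]

/-! Linear combinations of valuations. -/

theorem ext {μ ν : Val X} (h : ∀ U, μ U = ν U) : μ = ν := toFun_injective (funext h)

instance : Zero (Val X) :=
  ⟨{ toFun := fun _ => 0
     scottContinuous' := ScottContinuous.const 0
     strict' := rfl
     modular' := fun _ _ => rfl }⟩

end Val

/-! ### Scott continuity of the linear operations on `[0, ∞]` -/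

theorem ScottContinuous.ennreal_add {Z : Type*} [Preorder Z] {f g : Z → ℝ≥0∞}
    (hf : ScottContinuous f) (hg : ScottContinuous g) : ScottContinuous fun z => f z + g z := by
  intro d hne hd a ha
  have hF := hf hne hd ha
  have hG := hg hne hd ha
  refine ⟨?_, fun b hb => ?_⟩
  · rintro _ ⟨z, hz, rfl⟩
    exact add_le_add (hF.1 ⟨z, hz, rfl⟩) (hG.1 ⟨z, hz, rfl⟩)
  · have : Nonempty d := hne.to_subtype
    dsimp only
    rw [← hF.sSup_eq, ← hG.sSup_eq, sSup_image', sSup_image']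
    refine ENNReal.iSup_add_iSup_le fun y z => ?_
    obtain ⟨w, hw, h₁, h₂⟩ := hd _ y.2 _ z.2
    exact (add_le_add (hf.monotone h₁) (hg.monotone h₂)).trans (hb ⟨w, hw, rfl⟩)

theorem ScottContinuous.ennreal_const_mul {Z : Type*} [Preorder Z] {f : Z → ℝ≥0∞}
    (hf : ScottContinuous f) (r : ℝ≥0∞) : ScottContinuous fun z => r * f z := by
  intro d hne hd a ha
  have hF := hf hne hd ha
  dsimp only
  rw [← hF.sSup_eq, sSup_image', ENNReal.mul_iSup, ← sSup_image' (f := fun z => r * f z)]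
  exact isLUB_sSup _

namespace Val

variable {X : Type u} [PartialOrder X]

instance : Add (Val X) :=
  ⟨fun μ ν =>
    { toFun := fun U => μ U + ν U
      scottContinuous' := μ.scottContinuous'.ennreal_add ν.scottContinuous'
      strict' := by simp [strict']
      modular' := fun U V => by
        rw [add_add_add_comm, μ.modular', ν.modular', add_add_add_comm] }⟩

noncomputable instance : SMul ℝ≥0 (Val X) :=
  ⟨fun r ν =>
    { toFun := fun U => (r : ℝ≥0∞) * ν U
      scottContinuous' := ν.scottContinuous'.ennreal_const_mul r
      strict' := by simp [strict']
      modular' := fun U V => by rw [← mul_add, ν.modular', mul_add] }⟩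

noncomputable instance : SMul ℕ (Val X) := ⟨fun n ν => (n : ℝ≥0) • ν⟩

theorem zero_apply (U : ScottOpens X) : (0 : Val X) U = 0 := rfl

theorem add_apply (μ ν : Val X) (U : ScottOpens X) : (μ + ν) U = μ U + ν U := rfl

theorem smul_apply (r : ℝ≥0) (ν : Val X) (U : ScottOpens X) : (r • ν) U = r * ν U := rfl

noncomputable instance : AddCommMonoid (Val X) :=
  toFun_injective.addCommMonoid Val.toFun rfl (fun _ _ => rfl) fun ν n => by
    funext U
    change ((n : ℝ≥0) : ℝ≥0∞) * ν U = n • ν U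
    simp

/-- Evaluation of valuations at opens, as an additive map. -/
noncomputable def toFunHom : Val X →+ (ScottOpens X → ℝ≥0∞) where
  toFun := Val.toFun
  map_zero' := rfl
  map_add' _ _ := rfl

noncomputable instance : Module ℝ≥0 (Val X) :=
  Function.Injective.module ℝ≥0 toFunHom toFun_injective fun r ν => by
    funext U
    change (r : ℝ≥0∞) * ν U = r • ν U
    simp [ENNReal.smul_def]

theorem sum_apply {ι : Type*} (s : Finset ι) (ν : ι → Val X) (U : ScottOpens X) :
    (∑ i ∈ s, ν i) U = ∑ i ∈ s, ν i U :=
  (congrFun (map_sum toFunHom ν s) U).trans (Finset.sum_apply _ _ _)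

theorem integral_zero (h : LscMap X) : (0 : Val X).integral h = 0 := by
  simp [integral, zero_apply]

theorem integral_add (μ ν : Val X) (h : LscMap X) :
    (μ + ν).integral h = μ.integral h + ν.integral h :=
  MeasureTheory.lintegral_add_left (μ.antitone_superlevel h).measurable _

theorem integral_smul (r : ℝ≥0) (ν : Val X) (h : LscMap X) :
    (r • ν).integral h = r * ν.integral h :=
  MeasureTheory.lintegral_const_mul _ (ν.antitone_superlevel h).measurable

theorem isSimple_iff {ν : Val X} :
    ν.IsSimple ↔ ∃ (n : ℕ) (r : Fin n → ℝ≥0) (x : Fin n → X), ν = ∑ i, r i • dirac (x i) := by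
  refine exists_congr fun n => exists_congr fun r => exists_congr fun x => ⟨fun h => ?_, ?_⟩
  · refine ext fun U => ?_
    rw [h, sum_apply]; rfl
  · rintro rfl U
    rw [sum_apply]; rfl

end Val

/-! ### Induction over minimal valuations -/

/-- Maps agreeing on a directed set have the same image of it, and both send its supremum to the
supremum of that image. -/
theorem ScottContinuous.dirSupClosed_eq {Z Y : Type*} [Preorder Z] [PartialOrder Y] {f g : Z → Y}
    (hf : ScottContinuous f) (hg : ScottContinuous g) : DirSupClosed {z | f z = g z} := by
  intro d hdC hne hd a ha
  have h : f '' d = g '' d := Set.image_congr hdC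
  have hfa := hf hne hd ha
  rw [h] at hfa
  exact hfa.unique (hg hne hd ha)

theorem ScottContinuous.dirSupClosed_preimage {Z Y : Type*} [Preorder Z] [Preorder Y] {f : Z → Y}
    (hf : ScottContinuous f) {C : Set Y} (hC : DirSupClosed C) : DirSupClosed (f ⁻¹' C) := by
  intro d hdC hne hd a ha
  refine hC (Set.image_subset_iff.2 hdC) (hne.image f) ?_ (hf hne hd ha)
  exact directedOn_image.2 (hd.mono fun _ _ hab => hf.monotone hab)

namespace Val

variable {X : Type u} [PartialOrder X]

theorem scottContinuous_of_apply {Z : Type*} [Preorder Z] {f : Z → Val X}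
    (hf : ∀ U, ScottContinuous fun z => f z U) : ScottContinuous f := by
  intro d hne hd a ha
  constructor
  · rintro _ ⟨z, hz, rfl⟩ U
    exact (hf U hne hd ha).1 ⟨z, hz, rfl⟩
  · intro b hb U
    refine (hf U hne hd ha).2 ?_
    rintro _ ⟨z, hz, rfl⟩
    exact hb ⟨z, hz, rfl⟩ U

theorem scottContinuous_apply (U : ScottOpens X) : ScottContinuous fun ν : Val X => ν U := by
  intro d hne hd a ha
  dsimp only
  rw [isLUB_apply hd ha, ← sSup_image' (f := fun ν : Val X => ν U)]
  exact isLUB_sSup _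

theorem IsMinimal.of_isSimple {ν : Val X} (h : ν.IsSimple) : ν.IsMinimal :=
  fun _ hC => hC.1 h

theorem IsSimple.zero : (0 : Val X).IsSimple :=
  isSimple_iff.2 ⟨0, Fin.elim0, Fin.elim0, by simp⟩

theorem IsSimple.add {μ ν : Val X} (hμ : μ.IsSimple) (hν : ν.IsSimple) : (μ + ν).IsSimple := by
  obtain ⟨m, r, x, rfl⟩ := isSimple_iff.1 hμ
  obtain ⟨n, s, y, rfl⟩ := isSimple_iff.1 hν
  refine isSimple_iff.2 ⟨m + n, Fin.append r s, Fin.append x y, ?_⟩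
  simp [Fin.sum_univ_add]

theorem IsSimple.smul (r : ℝ≥0) {ν : Val X} (hν : ν.IsSimple) : (r • ν).IsSimple := by
  obtain ⟨n, s, y, rfl⟩ := isSimple_iff.1 hν
  refine isSimple_iff.2 ⟨n, fun i => r * s i, y, ?_⟩
  simp [Finset.smul_sum, mul_smul]

theorem IsSimple.dirac (x : X) : (dirac x).IsSimple :=
  isSimple_iff.2 ⟨1, fun _ => 1, fun _ => x, by simp⟩

/-- The preimage of the minimal valuations is closed under directed suprema and contains the simple
ones, hence contains their inductive closure. -/
theorem IsMinimal.map {f : Val X → Val X} (hf : ScottContinuous f)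
    (hs : ∀ ν : Val X, ν.IsSimple → (f ν).IsMinimal) {ν : Val X} (hν : ν.IsMinimal) :
    (f ν).IsMinimal :=
  hν (f ⁻¹' {μ | μ.IsMinimal})
    ⟨hs, hf.dirSupClosed_preimage (dirSupClosed_inductiveClosure _)⟩

theorem IsMinimal.add {μ ν : Val X} (hμ : μ.IsMinimal) (hν : ν.IsMinimal) :
    (μ + ν).IsMinimal := by
  -- One summand at a time: `ν` is reduced to a simple valuation with `μ` fixed, then `μ` with the
  -- simple `ν` fixed.
  refine hν.map (f := fun ν => μ + ν) (scottContinuous_of_apply fun U =>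
    ScottContinuous.ennreal_add (ScottContinuous.const _) (scottContinuous_apply U)) fun ν hν => ?_
  refine hμ.map (f := fun μ => μ + ν) (scottContinuous_of_apply fun U =>
    ScottContinuous.ennreal_add (scottContinuous_apply U) (ScottContinuous.const _)) fun μ hμ => ?_
  exact .of_isSimple (hμ.add hν)

theorem IsMinimal.smul (r : ℝ≥0) {ν : Val X} (hν : ν.IsMinimal) : (r • ν).IsMinimal :=
  hν.map (f := fun ν => r • ν) (scottContinuous_of_apply fun U =>
    (scottContinuous_apply U).ennreal_const_mul r) fun _ hν => .of_isSimple (hν.smul r)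

variable (X) in
/-- The minimal valuations form a submodule of all continuous valuations. -/
def minimalSubmodule : Submodule ℝ≥0 (Val X) where
  carrier := {ν | ν.IsMinimal}
  zero_mem' := .of_isSimple .zero
  add_mem' := IsMinimal.add
  smul_mem' r _ := IsMinimal.smul r

/-- A property of minimal valuations may be checked on Dirac valuations, when it is stable under
linear combinations and directed suprema. -/
theorem IsMinimal.induction {p : Val X → Prop} (dirac : ∀ x, p (dirac x)) (zero : p 0)
    (add : ∀ μ ν, p μ → p ν → p (μ + ν)) (smul : ∀ (r : ℝ≥0) ν, p ν → p (r • ν))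
    (closed : DirSupClosed {ν | p ν}) {ν : Val X} (hν : ν.IsMinimal) : p ν := by
  refine hν _ ⟨fun μ hμ => ?_, closed⟩
  obtain ⟨n, r, x, rfl⟩ := isSimple_iff.1 hμ
  exact Finset.sum_induction _ p add zero fun i _ => smul _ _ (dirac _)

end Val

/-! ### The dcpo of minimal valuations as an `ℝ≥0`-module -/

namespace MinVal

variable {X Y : Dcpo.{u}}

noncomputable instance : AddCommMonoid (MinVal X) :=
  inferInstanceAs (AddCommMonoid (Val.minimalSubmodule X))

noncomputable instance : Module ℝ≥0 (MinVal X) :=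
  inferInstanceAs (Module ℝ≥0 (Val.minimalSubmodule X))

theorem ext_val {μ ν : MinVal X} (h : ∀ U, val μ U = val ν U) : μ = ν :=
  Subtype.ext (Val.ext h)

theorem val_add (μ ν : MinVal X) : val (μ + ν) = val μ + val ν := rfl

theorem val_smul (r : ℝ≥0) (ν : MinVal X) : val (r • ν) = r • val ν := rfl

theorem scottContinuous_of_val {Z : Type*} [Preorder Z] {f : Z → MinVal X}
    (hf : ∀ U, ScottContinuous fun z => val (f z) U) : ScottContinuous f := by
  intro d hne hd a ha
  constructor
  · rintro _ ⟨z, hz, rfl⟩ U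
    exact (hf U hne hd ha).1 ⟨z, hz, rfl⟩
  · intro b hb U
    refine (hf U hne hd ha).2 ?_
    rintro _ ⟨z, hz, rfl⟩
    exact hb ⟨z, hz, rfl⟩ U

theorem scottContinuous_val : ScottContinuous (val : MinVal X → Val X) :=
  Val.scottContinuous_of_apply scottContinuous_eval

/-- The Dirac valuation as a minimal valuation. -/
noncomputable def dirac (x : X) : MinVal X := ⟨Val.dirac x, .of_isSimple (.dirac x)⟩

theorem induction {p : MinVal X → Prop} (hdirac : ∀ x, p (dirac x)) (hzero : p 0)
    (hadd : ∀ μ ν, p μ → p ν → p (μ + ν)) (hsmul : ∀ (r : ℝ≥0) ν, p ν → p (r • ν))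
    (closed : DirSupClosed {ν | p ν}) (ν : MinVal X) : p ν := by
  suffices h : ∃ hν : (val ν).IsMinimal, p ⟨val ν, hν⟩ from h.2
  -- Carrying the minimality proof inside the predicate lets induction over `Val X` speak of `p`,
  -- which is defined only on the subtype.
  refine Val.IsMinimal.induction (p := fun ν => ∃ hν : ν.IsMinimal, p ⟨ν, hν⟩)
    (fun x => ⟨_, hdirac x⟩) ⟨_, hzero⟩ ?_ ?_ ?_ ν.2
  · rintro μ ν ⟨_, hμ⟩ ⟨_, hν⟩
    exact ⟨_, hadd _ _ hμ hν⟩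
  · rintro r ν ⟨_, hν⟩
    exact ⟨_, hsmul r _ hν⟩
  · intro d hdC hne hd a ha
    have ham : a.IsMinimal :=
      dirSupClosed_inductiveClosure _ (fun ν hν => (hdC hν).1) hne hd ha
    refine ⟨ham, closed (d := {ν : MinVal X | val ν ∈ d}) ?_ ?_ ?_ (a := ⟨a, ham⟩) ⟨?_, ?_⟩⟩
    · intro ν hν
      exact (hdC hν).2
    · obtain ⟨ν, hν⟩ := hne
      exact ⟨⟨ν, (hdC hν).1⟩, hν⟩
    · intro μ hμ ν hν
      obtain ⟨ξ, hξ, h₁, h₂⟩ := hd _ hμ _ hν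
      exact ⟨⟨ξ, (hdC hξ).1⟩, hξ, h₁, h₂⟩
    · intro ν hν
      exact ha.1 hν
    · intro b hb
      exact ha.2 fun ν hν => @hb ⟨ν, (hdC hν).1⟩ hν

/-! ### Scott-continuous linear maps -/

/-- Scott-continuous linear maps between dcpos of minimal valuations. -/
structure IsScottLinear (f : MinVal X → MinVal Y) : Prop where
  scottContinuous : ScottContinuous f
  isLinearMap : IsLinearMap ℝ≥0 f

namespace IsScottLinear

theorem id : IsScottLinear fun μ : MinVal X => μ :=
  ⟨ScottContinuous.id, ⟨fun _ _ => rfl, fun _ _ => rfl⟩⟩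

theorem comp {Z : Dcpo.{u}} {f : MinVal X → MinVal Y} {g : MinVal Y → MinVal Z}
    (hg : IsScottLinear g) (hf : IsScottLinear f) : IsScottLinear fun μ => g (f μ) :=
  ⟨hf.1.comp hg.1, ⟨fun μ ν => by rw [hf.2.map_add, hg.2.map_add],
    fun r ν => by rw [hf.2.map_smul, hg.2.map_smul]⟩⟩

theorem add {f g : MinVal X → MinVal Y} (hf : IsScottLinear f) (hg : IsScottLinear g) :
    IsScottLinear fun μ => f μ + g μ :=
  ⟨scottContinuous_of_val fun U => (hf.1.comp (scottContinuous_eval U)).ennreal_add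
      (hg.1.comp (scottContinuous_eval U)),
    ⟨fun μ ν => by rw [hf.2.map_add, hg.2.map_add, add_add_add_comm],
     fun r ν => by rw [hf.2.map_smul, hg.2.map_smul, smul_add]⟩⟩

theorem smul {f : MinVal X → MinVal Y} (r : ℝ≥0) (hf : IsScottLinear f) :
    IsScottLinear fun μ => r • f μ :=
  ⟨scottContinuous_of_val fun U => (hf.1.comp (scottContinuous_eval U)).ennreal_const_mul r,
    ⟨fun μ ν => by rw [hf.2.map_add, smul_add],
     fun s ν => by rw [hf.2.map_smul, smul_comm]⟩⟩

/-- Scott-continuous linear maps are determined by their values at Dirac valuations. -/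
theorem eq_of_dirac {f g : MinVal X → MinVal Y} (hf : IsScottLinear f) (hg : IsScottLinear g)
    (h : ∀ x, f (dirac x) = g (dirac x)) (μ : MinVal X) : f μ = g μ := by
  refine induction (p := fun μ => f μ = g μ) h ?_ ?_ ?_ (hf.1.dirSupClosed_eq hg.1) μ
  · exact hf.2.mk'.map_zero.trans hg.2.mk'.map_zero.symm
  · intro μ ν hμ hν
    rw [hf.2.map_add, hg.2.map_add, hμ, hν]
  · intro r ν hν
    rw [hf.2.map_smul, hg.2.map_smul, hν]

end IsScottLinear

/-! ### The extension of a morphism -/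

/-- Induction on `ν`: a Dirac at `x` gives `f x`, and linear combinations and directed suprema are
formed in `MinVal Y`. Modularity, continuity in `V` and minimality of `V ↦ ∫ f x V dν` thus come
together. -/
theorem exists_ext (f : X ⟶ MinVal Y) {ν : Val X} (hν : ν.IsMinimal) :
    ∃ ρ : MinVal Y, ∀ V, val ρ V = ν.integral (evalMap f V) := by
  refine Val.IsMinimal.induction
    (p := fun ν : Val X => ∃ ρ : MinVal Y, ∀ V, val ρ V = ν.integral (evalMap f V))
    (fun x => ⟨f x, fun V => (Val.integral_dirac x (evalMap f V)).symm⟩)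
    ⟨0, fun V => (Val.integral_zero (evalMap f V)).symm⟩ ?_ ?_ ?_ hν
  · rintro μ ν ⟨ρ, hρ⟩ ⟨σ, hσ⟩
    exact ⟨ρ + σ, fun V => by rw [Val.integral_add, val_add, Val.add_apply, hρ, hσ]⟩
  · rintro r ν ⟨ρ, hρ⟩
    exact ⟨r • ρ, fun V => by rw [Val.integral_smul, val_smul, Val.smul_apply, hρ]⟩
  · intro d hdC hne hd a ha
    -- The set of all witnesses over `d` inherits directedness from `d` by monotonicity of the
    -- integral, so it has a supremum in the dcpo `MinVal Y`.
    let e : Set (MinVal Y) := {ρ | ∃ ν ∈ d, ∀ V, val ρ V = ν.integral (evalMap f V)}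
    have hene : e.Nonempty := by
      obtain ⟨ν, hν⟩ := hne
      obtain ⟨ρ, hρ⟩ := hdC hν
      exact ⟨ρ, ν, hν, hρ⟩
    have hed : DirectedOn (· ≤ ·) e := by
      rintro ρ ⟨μ, hμ, hρ⟩ σ ⟨ν, hν, hσ⟩
      obtain ⟨ξ, hξ, h₁, h₂⟩ := hd _ hμ _ hν
      obtain ⟨τ, hτ⟩ := hdC hξ
      refine ⟨τ, ⟨ξ, hξ, hτ⟩, fun V => ?_, fun V => ?_⟩
      · exact (hρ V).trans_le ((Val.integral_mono h₁ _).trans_eq (hτ V).symm)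
      · exact (hσ V).trans_le ((Val.integral_mono h₂ _).trans_eq (hτ V).symm)
    obtain ⟨ρ, hρ⟩ := (MinVal Y).exists_isLUB e hene hed
    refine ⟨ρ, fun V => (scottContinuous_eval V hene hed hρ).unique ?_⟩
    convert Val.integral_scottContinuous (evalMap f V) hne hd ha using 1
    ext t
    constructor
    · rintro ⟨σ, ⟨ν, hν, hσ⟩, rfl⟩
      exact ⟨ν, hν, (hσ V).symm⟩
    · rintro ⟨ν, hν, rfl⟩
      obtain ⟨σ, hσ⟩ := hdC hν
      exact ⟨σ, ⟨ν, hν, hσ⟩, hσ V⟩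

/-- The function underlying the extension of `f` to minimal valuations. -/
noncomputable def extFun (f : X ⟶ MinVal Y) (μ : MinVal X) : MinVal Y :=
  (exists_ext f μ.2).choose

theorem val_extFun (f : X ⟶ MinVal Y) (μ : MinVal X) (V : ScottOpens Y) :
    val (extFun f μ) V = (val μ).integral (evalMap f V) :=
  (exists_ext f μ.2).choose_spec V

theorem extFun_dirac (f : X ⟶ MinVal Y) (x : X) : extFun f (dirac x) = f x :=
  ext_val fun V => (val_extFun f _ V).trans (Val.integral_dirac x _)

theorem isScottLinear_extFun (f : X ⟶ MinVal Y) : IsScottLinear (extFun f) where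
  scottContinuous := scottContinuous_of_val fun V => by
    simp only [val_extFun]
    exact scottContinuous_val.comp (Val.integral_scottContinuous _)
  isLinearMap :=
    { map_add := fun μ ν => ext_val fun V => by
        simp only [val_extFun, val_add, Val.integral_add, Val.add_apply]
      map_smul := fun r ν => ext_val fun V => by
        simp only [val_extFun, val_smul, Val.integral_smul, Val.smul_apply] }

/-- As a function of the point this is the indicator of `U`: upper closure gives monotonicity,
inaccessibility gives preservation of suprema. -/
theorem _root_.ScottOpens.scottContinuous_dirac {X : Type u} [PartialOrder X]
    (U : ScottOpens X) : ScottContinuous fun x => Val.dirac x U := by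
  classical
  obtain ⟨h₁, h₂⟩ := isOpen_scott_iff.1
    (@TopologicalSpace.Opens.is_open' X (Topology.scott X Set.univ) U)
  intro d hne hd a ha
  constructor
  · rintro _ ⟨x, hx, rfl⟩
    by_cases hxU : x ∈ U
    · have haU : a ∈ U := h₁ (ha.1 hx) hxU
      simp [Val.dirac, hxU, haU]
    · simp [Val.dirac, hxU]
  · intro b hb
    by_cases haU : a ∈ U
    · obtain ⟨x, hx, hxU⟩ := h₂ hne hd ha haU
      have hxU' : x ∈ U := hxU
      simpa [Val.dirac, hxU', haU] using hb ⟨x, hx, rfl⟩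
    · simp [Val.dirac, haU]

/-- The unit `x ↦ δ_x`. -/
noncomputable def unit (X : Dcpo.{u}) : X ⟶ MinVal X :=
  Dcpo.Hom.mk dirac (scottContinuous_of_val ScottOpens.scottContinuous_dirac)

/-- The extension of `f` to minimal valuations. -/
noncomputable def ext (f : X ⟶ MinVal Y) : MinVal X ⟶ MinVal Y :=
  Dcpo.Hom.mk (extFun f) (isScottLinear_extFun f).1

theorem isScottLinear_ext (f : X ⟶ MinVal Y) : IsScottLinear (ext f) :=
  isScottLinear_extFun f

theorem ext_dirac (f : X ⟶ MinVal Y) (x : X) : ext f (dirac x) = f x := extFun_dirac f x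

theorem hom_ext {f g : MinVal X ⟶ MinVal Y} (hf : IsScottLinear f) (hg : IsScottLinear g)
    (h : ∀ x, f (dirac x) = g (dirac x)) : f = g :=
  ConcreteCategory.hom_ext _ _ (hf.eq_of_dirac hg h)

/-- The monad of minimal valuations. -/
noncomputable def monad : ManesMonad MinVal.{u} where
  unit := unit
  ext := ext
  unit_ext f := ConcreteCategory.hom_ext _ _ fun x => ext_dirac f x
  ext_unit _ := hom_ext (isScottLinear_ext _) .id fun x => ext_dirac _ x
  ext_comp_ext f g := hom_ext (isScottLinear_ext _)
    -- At `δ_x` both sides are `ext g (f x)`.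
    ((isScottLinear_ext g).comp (isScottLinear_ext f)) fun x =>
      (ext_dirac _ x).trans (congrArg (ext g) (ext_dirac f x).symm)

end MinVal

/-! ### The strength -/

namespace MinVal

variable {X Y Z : Dcpo.{u}}

/-- The section `y ↦ (x, y)`. -/
def _root_.Dcpo.pairHom (x : X) : Y ⟶ X ⊗ Y :=
  Dcpo.Hom.mk (fun y => Dcpo.pair x y) (Dcpo.scottContinuous_pair x)

/-- The function `ν ↦ t (x, ν)`. -/
noncomputable def strengthFun (x : X) (ν : MinVal Y) : MinVal (X ⊗ Y) :=
  ext (Dcpo.pairHom x ≫ unit (X ⊗ Y)) ν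

theorem isScottLinear_strengthFun (x : X) :
    IsScottLinear (strengthFun x : MinVal Y → MinVal (X ⊗ Y)) :=
  isScottLinear_ext _

theorem strengthFun_dirac (x : X) (y : Y) : strengthFun x (dirac y) = dirac (Dcpo.pair x y) :=
  ext_dirac _ y

/-- Defining the strength as an extension gives minimality and linearity at once. The slice formula
follows because both sides are linear and Scott-continuous in `ν` and agree on Diracs. -/
theorem val_strengthFun (x : X) (ν : MinVal Y) (W : ScottOpens ↥(X ⊗ Y)) :
    val (strengthFun x ν) W = val ν (Dcpo.slice x W) := by
  refine induction (p := fun ν => val (strengthFun x ν) W = val ν (Dcpo.slice x W)) ?_ ?_ ?_ ?_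
    (((isScottLinear_strengthFun x).1.comp (scottContinuous_eval W)).dirSupClosed_eq
      (scottContinuous_eval _)) ν
  · intro y
    rw [strengthFun_dirac]; rfl
  · rw [show strengthFun x (0 : MinVal Y) = 0 from
      (isScottLinear_strengthFun x).2.mk'.map_zero]; rfl
  · intro μ ν hμ hν
    rw [(isScottLinear_strengthFun x).2.map_add, val_add, Val.add_apply, hμ, hν]; rfl
  · intro r ν hν
    rw [(isScottLinear_strengthFun x).2.map_smul, val_smul, Val.smul_apply, hν]; rfl

theorem _root_.Dcpo.scottContinuous_pair_left (y : Y) :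
    ScottContinuous fun x : X => (Dcpo.pair x y : ↥(X ⊗ Y)) :=
  ScottContinuous.prodMk ScottContinuous.id (ScottContinuous.const y)

/-- For each fixed `y`, the section `{x | (x, y) ∈ W}` is Scott-open. -/
theorem _root_.Dcpo.scottContinuous_slice (W : ScottOpens ↥(X ⊗ Y)) :
    ScottContinuous fun x : X => Dcpo.slice x W := by
  intro d hne hd a ha
  constructor
  · rintro _ ⟨x, hx, rfl⟩ y hy
    exact (isOpen_scott_iff.1 (@TopologicalSpace.Opens.is_open' X (Topology.scott X Set.univ)
      (ScottOpens.preimage _ (Dcpo.scottContinuous_pair_left y) W))).1 (ha.1 hx) hy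
  · intro B hB y hy
    obtain ⟨x, hx, hxy⟩ := (isOpen_scott_iff.1 (@TopologicalSpace.Opens.is_open' X
      (Topology.scott X Set.univ)
      (ScottOpens.preimage _ (Dcpo.scottContinuous_pair_left y) W))).2 hne hd ha hy
    exact hB ⟨x, hx, rfl⟩ hxy

theorem scottContinuous_strengthFun_left (ν : MinVal Y) :
    ScottContinuous fun x : X => strengthFun x ν :=
  scottContinuous_of_val fun W => by
    simp only [val_strengthFun]
    exact (Dcpo.scottContinuous_slice W).comp (val ν).scottContinuous'

/-- The strength `t (x, ν) W = ν {y | (x, y) ∈ W}`. -/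
noncomputable def strength (X Y : Dcpo.{u}) : X ⊗ MinVal Y ⟶ MinVal (X ⊗ Y) :=
  Dcpo.Hom.mk (fun p : X × MinVal Y => strengthFun p.1 p.2)
    -- Separate Scott continuity implies joint Scott continuity.
    (.fromProd (fun x => (isScottLinear_strengthFun x).1) scottContinuous_strengthFun_left)

theorem isScottLinear_strength (x : X) :
    IsScottLinear fun ν : MinVal Y => strength X Y (Dcpo.pair x ν) :=
  isScottLinear_strengthFun x

theorem strength_dirac (x : X) (y : Y) :
    strength X Y (Dcpo.pair x (dirac y)) = dirac (Dcpo.pair x y) :=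
  strengthFun_dirac x y

/-- Morphisms out of `X ⊗ MinVal Y` that are linear in the second argument are determined by their
values on Dirac valuations. -/
theorem tensor_hom_ext {f g : X ⊗ MinVal Y ⟶ MinVal Z}
    (hf : ∀ x, IsScottLinear fun ν : MinVal Y => f (Dcpo.pair x ν))
    (hg : ∀ x, IsScottLinear fun ν : MinVal Y => g (Dcpo.pair x ν))
    (h : ∀ x y, f (Dcpo.pair x (dirac y)) = g (Dcpo.pair x (dirac y))) : f = g :=
  ConcreteCategory.hom_ext _ _ fun p : X × MinVal Y => (hf p.1).eq_of_dirac (hg p.1) (h p.1) p.2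

theorem monad_map_dirac (f : X ⟶ Y) (x : X) : monad.map f (dirac x) = dirac (f x) :=
  ext_dirac _ x

theorem isScottLinear_map (f : X ⟶ Y) : IsScottLinear (monad.map f) := isScottLinear_ext _

theorem monad_mult_dirac (ν : MinVal X) : monad.mult X (dirac ν) = ν :=
  ext_dirac _ ν

theorem isScottLinear_mult (X : Dcpo.{u}) : IsScottLinear (monad.mult X) := isScottLinear_ext _

/-- The strong monad of minimal valuations. -/
noncomputable def strongMonad : StrongMonad MinVal.{u} where
  toManesMonad := monad
  strength := strength
  strength_natural {X X' Y Y'} f g := by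
    refine tensor_hom_ext
      (fun x => (isScottLinear_strength (f x)).comp (isScottLinear_map g))
      (fun x => (isScottLinear_map _).comp (isScottLinear_strength x)) fun x y => ?_
    change strength X' Y' (Dcpo.pair (f x) (monad.map g (dirac y))) =
      monad.map (f ⊗ₘ g) (strength X Y (Dcpo.pair x (dirac y)))
    rw [monad_map_dirac, strength_dirac, strength_dirac, monad_map_dirac]; rfl
  strength_leftUnitor X := by
    refine tensor_hom_ext
      (fun x => (isScottLinear_map _).comp (isScottLinear_strength x)) (fun x => .id) fun x y => ?_
    change monad.map (λ_ X).hom (strength (𝟙_ Dcpo.{u}) X (Dcpo.pair x (dirac y))) = dirac y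
    rw [strength_dirac, monad_map_dirac]; rfl
  strength_associator X Y Z := by
    refine tensor_hom_ext
      (fun x => (isScottLinear_map _).comp (isScottLinear_strength x))
      (fun x : X × Y => (isScottLinear_strength x.1).comp (isScottLinear_strength x.2))
      fun x z => ?_
    obtain ⟨x, y⟩ : X × Y := x
    change monad.map (α_ X Y Z).hom (strength (X ⊗ Y) Z (Dcpo.pair (Dcpo.pair x y) (dirac z))) =
      strength X (Y ⊗ Z) (Dcpo.pair x (strength Y Z (Dcpo.pair y (dirac z))))
    rw [strength_dirac, strength_dirac, strength_dirac, monad_map_dirac]; rfl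
  strength_unit X Y := ConcreteCategory.hom_ext _ _ fun p : X × Y => strength_dirac p.1 p.2
  strength_mult X Y := by
    -- Here the second factor is `MinVal (MinVal Y)`, so the test elements are Diracs `δ_ν` at
    -- valuations; both sides become `t (x, ν)`.
    refine tensor_hom_ext
      (fun x => (isScottLinear_strength x).comp (isScottLinear_mult Y))
      (fun x => (isScottLinear_mult _).comp
        ((isScottLinear_map _).comp (isScottLinear_strength x))) fun x ν => ?_
    change strength X Y (Dcpo.pair x (monad.mult Y (dirac ν))) =
      monad.mult (X ⊗ Y) (monad.map (strength X Y)
        (strength X (MinVal Y) (Dcpo.pair x (dirac ν))))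
    rw [monad_mult_dirac, strength_dirac, monad_map_dirac, monad_mult_dirac]

/-! ### Commutativity -/

theorem isScottLinear_dualStrength (y : Y) :
    IsScottLinear fun μ : MinVal X => strongMonad.dualStrength X Y (Dcpo.pair μ y) :=
  (isScottLinear_map (prodSwap Y X)).comp (isScottLinear_strength y)

theorem dualStrength_dirac (x : X) (y : Y) :
    strongMonad.dualStrength X Y (Dcpo.pair (dirac x) y) = dirac (Dcpo.pair x y) := by
  change monad.map (prodSwap Y X) (strength Y X (Dcpo.pair y (dirac x))) = _
  rw [strength_dirac, monad_map_dirac]; rfl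

theorem isScottLinear_dualStrength_ext_left (μ : MinVal X) :
    IsScottLinear fun ν : MinVal Y =>
      ext (strongMonad.dualStrength X Y) (strength (MinVal X) Y (Dcpo.pair μ ν)) :=
  (isScottLinear_ext _).comp (isScottLinear_strength μ)

/-- Linearity in `μ` is not a matter of composition, since `t (μ, ν)` is not linear in `μ`. Each
identity is instead linear in `ν`, and at `ν = δ_y` it becomes linearity of `t' (μ, y)` in `μ`. -/
theorem isScottLinear_dualStrength_ext_right (ν : MinVal Y) :
    IsScottLinear fun μ : MinVal X =>
      ext (strongMonad.dualStrength X Y) (strength (MinVal X) Y (Dcpo.pair μ ν)) where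
  scottContinuous := (scottContinuous_strengthFun_left ν).comp (isScottLinear_ext _).1
  isLinearMap :=
    { map_add := fun μ₁ μ₂ => (isScottLinear_dualStrength_ext_left _).eq_of_dirac
        ((isScottLinear_dualStrength_ext_left _).add (isScottLinear_dualStrength_ext_left _))
        (fun y => by
          simp only [strength_dirac, ext_dirac]
          exact (isScottLinear_dualStrength y).2.map_add μ₁ μ₂) ν
      map_smul := fun r μ => (isScottLinear_dualStrength_ext_left _).eq_of_dirac
        ((isScottLinear_dualStrength_ext_left _).smul r)
        (fun y => by
          simp only [strength_dirac, ext_dirac]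
          exact (isScottLinear_dualStrength y).2.map_smul r μ) ν }

theorem strongMonad_isCommutative : strongMonad.{u}.IsCommutative := by
  intro X Y
  refine ConcreteCategory.hom_ext _ _ fun p : MinVal X × MinVal Y => ?_
  obtain ⟨μ, ν⟩ := p
  refine IsScottLinear.eq_of_dirac
    (f := fun μ : MinVal X => ext (strength X Y)
      (strongMonad.dualStrength X (MinVal Y) (Dcpo.pair μ ν)))
    ((isScottLinear_ext _).comp (isScottLinear_dualStrength ν))
    (isScottLinear_dualStrength_ext_right ν) (fun x => ?_) μ
  -- With `μ = δ_x` the left side collapses to `t (x, ν)`, linear in `ν`, so `ν` may be taken Dirac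
  -- as well.
  rw [dualStrength_dirac, ext_dirac]
  refine IsScottLinear.eq_of_dirac (isScottLinear_strength x)
    (isScottLinear_dualStrength_ext_left _) (fun y => ?_) ν
  rw [strength_dirac, strength_dirac, ext_dirac, dualStrength_dirac]

end MinVal

theorem mainTheorem1 :
    ∃ M : StrongMonad MinVal.{u},
      -- the unit is `x ↦ δ_x`
      (∀ (X : Dcpo.{u}) (x : X), MinVal.val (M.unit X x) = Val.dirac x) ∧
      -- the extension is `f† μ V = ∫ f x V dμ`
      (∀ (X Y : Dcpo.{u}) (f : X ⟶ MinVal Y) (μ : MinVal X) (V : ScottOpens Y),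
        MinVal.val (M.ext f μ) V = (MinVal.val μ).integral (MinVal.evalMap f V)) ∧
      -- the strength is `t (x, ν) W = ν {y | (x, y) ∈ W}`
      (∀ (X Y : Dcpo.{u}) (x : X) (ν : MinVal Y) (W : ScottOpens ↥(X ⊗ Y)),
        MinVal.val (M.strength X Y (Dcpo.pair x ν)) W = MinVal.val ν (Dcpo.slice x W)) ∧
      M.IsCommutative :=
  ⟨MinVal.strongMonad, fun _ _ => rfl, fun _ _ f μ V => MinVal.val_extFun f μ V,
    fun _ _ x ν W => MinVal.val_strengthFun x ν W, MinVal.strongMonad_isCommutative⟩
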